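/- Let $E,J,R\in\mathbb C^{n\times n}$ and $B\in\mathbb C^{n\times m}$ with $E=E^H\ge 0$, $R=R^H\ge 0$ and $J=-J^H$, so that $E\dot x=(J-R)x+Bu$, $y=B^Hx$ is a port-Hamiltonian descriptor system. For a matrix $M$ let $\mathcal S_\infty(M)$ denote a matrix of full column rank whose columns span the right nullspace $\{x: Mx=0\}$, and $\mathcal T_\infty(M)$ a matrix of full column rank whose columns span the left nullspace $\{x: x^HM=0\}$. A pair $(\hat E,A)$ of $n\times n$ matrices is regular if $\det(s\hat E-A)\ne 0$ for some $s\in\mathbb C$; the index of a regular pair is the size of the largest nilpotent Jordan block belonging to the eigenvalue $\infty$ in its Weierstrass (Kronecker) canonical form, that is, the nilpotency index of $N$ in any decomposition $S(\lambda\hat E-A)T=\operatorname{diag}(\lambda I-C,\ \lambda N-I)$ with $S,T$ nonsingular and $N$ nilpotent (and $0$ if $\hat E$ is invertible). Then, for every choice of the nullspace matrices below, there exists a matrix $K\in\mathbb C^{m\times m}$ such that $E+BKB^H\ge 0$ (Hermitian positive semidefinite) and the pair $(E+BKB^H,\,J-R)$ is regular and of index at most one if and only if both $$\operatorname{rank}\,[\,E,\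 J-R,\ B\,]=n$$ and $$\operatorname{rank}\Bigl(\mathcal T_\infty^H(B)\,E\,\mathcal S_\infty\bigl(\mathcal T_\infty^H([\,E,\ B\,])\,(J-R)\bigr)\Bigr)=\operatorname{rank}\,[\,E,\ B\,]-\operatorname{rank} B .$$ -/

import Mathlib

open scoped Matrix ComplexOrder

/-- The matrix pair `(E, A)`, i.e. the pencil `λ E - A`, is regular. -/
def IsRegularPencil {n : ℕ} (E A : Matrix (Fin n) (Fin n) ℂ) : Prop :=
  ∃ s : ℂ, (s • E - A).det ≠ 0

/-- The regular pencil `λ E - A` has index `ν`: there are nonsingular `S`, `T` which bring it to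
Weierstrass form `S (λ E - A) T = diag (λ I - C, λ N - I)` with `N` nilpotent, and `ν` is the
nilpotency index of `N`, i.e. the size of the largest nilpotent Jordan block of `N`.
If the block `N` is absent (`E` invertible), its nilpotency index is `0`. -/
def HasPencilIndex {n : ℕ} (E A : Matrix (Fin n) (Fin n) ℂ) (ν : ℕ) : Prop :=
  ∃ (p q : ℕ) (e : Fin p ⊕ Fin q ≃ Fin n) (S T : Matrix (Fin n) (Fin n) ℂ)
    (C : Matrix (Fin p) (Fin p) ℂ) (N : Matrix (Fin q) (Fin q) ℂ),
    IsUnit S ∧ IsUnit T ∧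
    S * E * T = (Matrix.fromBlocks 1 0 0 N).reindex e e ∧
    S * A * T = (Matrix.fromBlocks C 0 0 1).reindex e e ∧
    IsNilpotent N ∧ nilpotencyClass N = ν

/-- `S` is a matrix of full column rank whose columns span the right nullspace of `M`. -/
def IsRightNullBasis {l n k : ℕ} (M : Matrix (Fin l) (Fin n) ℂ)
    (S : Matrix (Fin n) (Fin k) ℂ) : Prop :=
  LinearIndependent ℂ S.col ∧
    (Submodule.span ℂ (Set.range S.col) : Set (Fin n → ℂ)) = {x | M *ᵥ x = 0}

/-- `T` is a matrix of full column rank whose columns span the left nullspace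
`{x | xᴴ M = 0}` of `M`. -/
def IsLeftNullBasis {n k : ℕ} {ι : Type*} [Fintype ι] (M : Matrix (Fin n) ι ℂ)
    (T : Matrix (Fin n) (Fin k) ℂ) : Prop :=
  LinearIndependent ℂ T.col ∧
    (Submodule.span ℂ (Set.range T.col) : Set (Fin n → ℂ)) = {x | star x ᵥ* M = 0}

/-- Every matrix has a right nullspace basis matrix. -/
theorem exists_isRightNullBasis {l n : ℕ} (M : Matrix (Fin l) (Fin n) ℂ) :
    ∃ (k : ℕ) (S : Matrix (Fin n) (Fin k) ℂ), IsRightNullBasis M S := by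
  let b := Module.finBasis ℂ (LinearMap.ker M.mulVecLin)
  refine ⟨_, Matrix.of fun i j => (b j : Fin n → ℂ) i, ?_, ?_⟩
  · exact b.linearIndependent.map' (Submodule.subtype _) (Submodule.ker_subtype _)
  · have h : Submodule.span ℂ (Set.range fun j => (b j : Fin n → ℂ)) =
        LinearMap.ker M.mulVecLin := by
      have h1 := congrArg (Submodule.map (Submodule.subtype (LinearMap.ker M.mulVecLin)))
        b.span_eq
      rw [Submodule.map_span, ← Set.range_comp, Submodule.map_top, Submodule.range_subtype] at h1
      exact h1
    ext x
    exact (SetLike.ext_iff.mp h x).trans (by simp)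

/-- Every matrix has a left nullspace basis matrix. -/
theorem exists_isLeftNullBasis {n : ℕ} {ι : Type*} [Fintype ι]
    (M : Matrix (Fin n) ι ℂ) :
    ∃ (k : ℕ) (T : Matrix (Fin n) (Fin k) ℂ), IsLeftNullBasis M T := by
  let e := Fintype.equivFin ι
  obtain ⟨k, T, h1, h2⟩ := exists_isRightNullBasis (Mᴴ.submatrix e.symm id)
  refine ⟨k, T, h1, h2.trans ?_⟩
  ext x
  have h3 : ∀ i, (Mᴴ *ᵥ x) i = star ((star x ᵥ* M) i) := fun i => by
    rw [← star_star x, ← Matrix.star_vecMul, star_star]; rfl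
  simp only [Set.mem_ofPred_eq, funext_iff, Pi.zero_apply]
  constructor
  · intro h i
    have h4 := h (e i)
    have h5 : (Mᴴ *ᵥ x) i = 0 := by
      simpa [Matrix.mulVec, dotProduct] using h4
    rw [h3, star_eq_zero] at h5
    exact h5
  · intro h j
    have h5 := h3 (e.symm j)
    rw [h (e.symm j), star_zero] at h5
    exact h5

/-! ### Orthogonal projections, adjoints and factorizations in coordinates. -/

namespace Matrix

variable {l m n : ℕ}

/-! Put A = J - R, U = ker Bᴴ and V = ker E ∩ U. A Hermitian F has the form E + BKBᴴ exactly when F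
= E on U, so K disappears from the problem. The rank conditions become: (1) ker E ∩ ker Aᴴ ∩ ker Bᴴ
= 0; (2) if z ∈ U, v ∈ V and Ez = Aᴴv, then Ez = 0 (`rank_eq_rank_sub_rank_iff`).

The pencil λF - A is regular of index at most one if ker F ∩ A⁻¹(range F) = 0
(`isRegularPencil_and_hasPencilIndex_of_ker`). As F is Hermitian, it suffices that the form zᴴAx is
nondegenerate on ker F.

For sufficiency, ker F can be any subspace Z between V and ker F₀, where F₀ is the minimal choice,
with ker F₀ = (EU)^⊥. The form may be degenerate on V; let N be its radical. Its vectors are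
isotropic, so dissipativity gives Aᴴ = -A on N. Adding to V the projection of AN onto ker F₀ pairs
off the radical; any remaining degenerate vector v has Av ∈ EU, and (2), then (1), force v = 0.

For necessity, (1) follows from regularity, and (2) by splitting Aᴴv along ker F and A⁻¹(range F).
-/

theorem star_dotProduct_mulVec_eq (M : Matrix (Fin l) (Fin n) ℂ) (x : Fin l → ℂ) (y : Fin n → ℂ) :
    star x ⬝ᵥ (M *ᵥ y) = star (Mᴴ *ᵥ x) ⬝ᵥ y := by
  rw [dotProduct_mulVec, star_mulVec, conjTranspose_conjTranspose]

theorem star_dotProduct_eq_zero_comm {x y : Fin n → ℂ} (h : star x ⬝ᵥ y = 0) :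
    star y ⬝ᵥ x = 0 := by
  rw [← star_eq_zero, ← h, star_dotProduct, star_star]

/-- A matrix representing the orthogonal projection onto a subspace. -/
theorem exists_orthogonal_projection (U : Submodule ℂ (Fin n → ℂ)) :
    ∃ P : Matrix (Fin n) (Fin n) ℂ, Pᴴ = P ∧ P * P = P ∧ (∀ x, P *ᵥ x ∈ U) ∧
      ∀ x ∈ U, P *ᵥ x = x := by
  let W : Submodule ℂ (EuclideanSpace ℂ (Fin n)) :=
    U.map (WithLp.linearEquiv 2 ℂ (Fin n → ℂ)).symm.toLinearMap
  let Φ := toEuclideanCLM (n := Fin n) (𝕜 := ℂ)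
  have hP : IsStarProjection W.starProjection := isStarProjection_starProjection
  have key : ∀ x : Fin n → ℂ,
      WithLp.toLp 2 (Φ.symm W.starProjection *ᵥ x) = W.starProjection (WithLp.toLp 2 x) := by
    intro x
    have h := toEuclideanCLM_toLp (Φ.symm W.starProjection) x
    rw [← h]
    exact congrArg (fun f => f (WithLp.toLp 2 x)) (Φ.apply_symm_apply W.starProjection)
  refine ⟨Φ.symm W.starProjection, ?_, ?_, ?_, ?_⟩
  · have h := Φ.symm.map_star' W.starProjection
    rw [hP.isSelfAdjoint.star_eq] at h
    exact h.symm
  · rw [← map_mul, hP.isIdempotentElem.eq]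
  · intro x
    have h : W.starProjection (WithLp.toLp 2 x) ∈ W := Submodule.starProjection_apply_mem _ _
    rw [← key] at h
    obtain ⟨u, hu, h⟩ := h
    have : u = Φ.symm W.starProjection *ᵥ x := by
      have := congrArg WithLp.ofLp h
      simpa using this
    exact this ▸ hu
  · intro x hx
    have hxW : WithLp.toLp 2 x ∈ W := ⟨x, hx, rfl⟩
    have h := key x
    rw [Submodule.starProjection_eq_self_iff.2 hxW] at h
    simpa using congrArg WithLp.ofLp h

theorem projection_mulVec_eq_zero_iff {P : Matrix (Fin n) (Fin n) ℂ} {U : Submodule ℂ (Fin n → ℂ)}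
    (hP : Pᴴ = P) (hm : ∀ x, P *ᵥ x ∈ U) (he : ∀ x ∈ U, P *ᵥ x = x) (y : Fin n → ℂ) :
    P *ᵥ y = 0 ↔ ∀ x ∈ U, star x ⬝ᵥ y = 0 := by
  constructor
  · intro h x hx
    rw [← he x hx]
    nth_rw 1 [← hP]
    rw [← star_dotProduct_mulVec_eq, h, dotProduct_zero]
  · intro h
    rw [← dotProduct_star_self_eq_zero, star_dotProduct_mulVec_eq, hP, he _ (hm y)]
    exact h _ (hm y)

theorem projection_mulVec_eq_zero {P : Matrix (Fin n) (Fin n) ℂ} (hP : Pᴴ = P) (hPP : P * P = P)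
    {y : Fin n → ℂ} (h : star y ⬝ᵥ (P *ᵥ y) = 0) : P *ᵥ y = 0 := by
  rw [← dotProduct_star_self_eq_zero]
  nth_rw 1 [← hP]
  rw [← star_dotProduct_mulVec_eq, mulVec_mulVec, hPP, h]

/-- A vector orthogonal to the kernel of `M` lies in the range of `Mᴴ`. -/
theorem exists_conjTranspose_mulVec_eq (M : Matrix (Fin l) (Fin n) ℂ) (y : Fin n → ℂ)
    (h : ∀ x, M *ᵥ x = 0 → star x ⬝ᵥ y = 0) : ∃ w, Mᴴ *ᵥ w = y := by
  obtain ⟨P, hP, -, hPm, hPe⟩ := exists_orthogonal_projection (LinearMap.range Mᴴ.mulVecLin)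
  obtain ⟨w, hw⟩ := hPm y
  refine ⟨w, ?_⟩
  have hw' : Mᴴ *ᵥ w = P *ᵥ y := hw
  have hMP : P * Mᴴ = Mᴴ := by
    refine ext_of_mulVec_single fun i => ?_
    rw [← mulVec_mulVec]
    exact hPe _ ⟨_, rfl⟩
  have hMP' : M * P = M := by
    have := congrArg conjTranspose hMP
    rwa [conjTranspose_mul, conjTranspose_conjTranspose, hP] at this
  -- The residual y - Py lies in ker M, so it is orthogonal to y by hypothesis and to Py ∈ range Mᴴ;
  -- hence it is zero.
  have h0 : M *ᵥ (y - P *ᵥ y) = 0 := by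
    rw [mulVec_sub, mulVec_mulVec, hMP', sub_self]
  have h1 : star (y - P *ᵥ y) ⬝ᵥ (P *ᵥ y) = 0 := by
    nth_rw 2 [← hw']
    rw [star_dotProduct_mulVec_eq, conjTranspose_conjTranspose, h0]; simp
  have h2 : star (y - P *ᵥ y) ⬝ᵥ (y - P *ᵥ y) = 0 := by
    rw [dotProduct_sub, h1, h _ h0, sub_zero]
  rw [dotProduct_star_self_eq_zero] at h2
  rw [hw', ← sub_eq_zero, ← neg_sub, h2, neg_zero]

theorem exists_generalized_inverse (M : Matrix (Fin l) (Fin n) ℂ) :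
    ∃ L : Matrix (Fin n) (Fin l) ℂ, M * L * M = M := by
  obtain ⟨g, hg⟩ := M.mulVecLin.rangeRestrict.exists_rightInverse_of_surjective
    (LinearMap.range_rangeRestrict _)
  obtain ⟨g', hg'⟩ := LinearMap.exists_extend g
  refine ⟨LinearMap.toMatrix' g', ext_of_mulVec_single fun i => ?_⟩
  set x : Fin n → ℂ := Pi.single i 1
  have h1 : g' (M *ᵥ x) = g (M.mulVecLin.rangeRestrict x) := by
    rw [← hg']; rfl
  have h2 := congrArg Subtype.val (LinearMap.congr_fun hg (M.mulVecLin.rangeRestrict x))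
  rw [← mulVec_mulVec, ← mulVec_mulVec, LinearMap.toMatrix'_mulVec, h1]
  exact h2

/-- A Hermitian matrix vanishing on the kernel of `Bᴴ` factors as `B K Bᴴ`. -/
theorem IsHermitian.exists_eq_mul_mul_conjTranspose {D : Matrix (Fin n) (Fin n) ℂ}
    (hD : D.IsHermitian) (B : Matrix (Fin n) (Fin m) ℂ)
    (h : ∀ x, Bᴴ *ᵥ x = 0 → D *ᵥ x = 0) : ∃ K : Matrix (Fin m) (Fin m) ℂ, D = B * K * Bᴴ := by
  obtain ⟨L, hL⟩ := exists_generalized_inverse Bᴴ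
  -- Every x - L Bᴴ x lies in ker Bᴴ, where D vanishes.
  have h1 : D * (L * Bᴴ) = D := by
    refine ext_of_mulVec_single fun i => ?_
    rw [← sub_eq_zero, ← mulVec_mulVec, ← mulVec_sub]
    apply h
    rw [mulVec_sub, mulVec_mulVec, ← Matrix.mul_assoc, hL, sub_self]
  have h2 : B * Lᴴ * D = D := by
    have := congrArg Matrix.conjTranspose h1
    rwa [conjTranspose_mul, conjTranspose_mul, hD.eq, conjTranspose_conjTranspose] at this
  exact ⟨Lᴴ * D * L, by rw [← Matrix.mul_assoc, ← Matrix.mul_assoc, h2, Matrix.mul_assoc, h1]⟩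

/-- For `M = J - R` with `J` skew-Hermitian and `R ≥ 0`, isotropic vectors are killed by `R`. -/
theorem conjTranspose_sub_mulVec_eq_neg {J R : Matrix (Fin n) (Fin n) ℂ} (hR : R.PosSemidef)
    (hJ : Jᴴ = -J) {x : Fin n → ℂ} (h : star x ⬝ᵥ ((J - R) *ᵥ x) = 0) :
    (J - R)ᴴ *ᵥ x = -((J - R) *ᵥ x) := by
  have h1 : star x ⬝ᵥ ((J - R)ᴴ *ᵥ x) = 0 := by
    rw [star_dotProduct_mulVec_eq, conjTranspose_conjTranspose]
    exact star_dotProduct_eq_zero_comm h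
  have hA : (J - R)ᴴ = -J - R := by rw [conjTranspose_sub, hJ, hR.isHermitian.eq]
  -- The forms of J - R and of its adjoint -J - R both vanish at x, and they add up to -2 xᴴRx.
  have h2 : R *ᵥ x = 0 := by
    rw [← hR.dotProduct_mulVec_zero_iff]
    rw [hA, sub_mulVec, neg_mulVec, dotProduct_sub, dotProduct_neg] at h1
    rw [sub_mulVec, dotProduct_sub] at h
    linear_combination (-1 / 2 : ℂ) * (h + h1)
  rw [hA, sub_mulVec, sub_mulVec, neg_mulVec, h2, sub_zero, sub_zero]

end Matrix

/-! ### Choosing the kernel of the modified matrix F. -/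

namespace Matrix

variable {l m n : ℕ}

/-- A positive semidefinite `F₀` which agrees with `E` on `U` and is as small as possible
otherwise: its kernel is the orthogonal complement of `E U`. -/
theorem PosSemidef.exists_minimal {E : Matrix (Fin n) (Fin n) ℂ} (hE : E.PosSemidef)
    (U : Submodule ℂ (Fin n → ℂ)) :
    ∃ F₀ : Matrix (Fin n) (Fin n) ℂ, F₀.PosSemidef ∧ (∀ z ∈ U, F₀ *ᵥ z = E *ᵥ z) ∧
      ∀ x, F₀ *ᵥ x = 0 ↔ ∀ z ∈ U, star z ⬝ᵥ (E *ᵥ x) = 0 := by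
  obtain ⟨C, rfl⟩ : ∃ C : Matrix (Fin n) (Fin n) ℂ, E = Cᴴ * C := by
    open scoped MatrixOrder in
    exact CStarAlgebra.nonneg_iff_eq_star_mul_self.mp hE.nonneg
  -- With E = CᴴC, compressing to CU leaves E unchanged on U and kills every x with Cx orthogonal to
  -- CU.
  obtain ⟨P, hP, hPP, hPm, hPe⟩ := exists_orthogonal_projection (U.map C.mulVecLin)
  have hF : Cᴴ * P * C = (P * C)ᴴ * (P * C) := by
    rw [conjTranspose_mul, hP, Matrix.mul_assoc, Matrix.mul_assoc, ← Matrix.mul_assoc P P, hPP]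
  refine ⟨Cᴴ * P * C, hF ▸ posSemidef_conjTranspose_mul_self _, fun z hz => ?_, fun x => ?_⟩
  · rw [← mulVec_mulVec, ← mulVec_mulVec, ← mulVec_mulVec, hPe (C *ᵥ z) ⟨z, hz, rfl⟩]
  · rw [hF, conjTranspose_mul_self_mulVec_eq_zero, ← mulVec_mulVec,
      projection_mulVec_eq_zero_iff hP hPm hPe]
    simp [← mulVec_mulVec, star_dotProduct_mulVec_eq Cᴴ]

/-- The kernel of a positive semidefinite matrix can be cut down to any subspace `Z` of it
without changing the matrix on `U`, provided that `Z` contains `U ∩ ker F₀`. -/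
theorem PosSemidef.exists_ker_eq {F₀ : Matrix (Fin n) (Fin n) ℂ} (hF₀ : F₀.PosSemidef)
    (U Z : Submodule ℂ (Fin n → ℂ)) (hZ : ∀ x ∈ Z, F₀ *ᵥ x = 0)
    (hUZ : ∀ x ∈ U, F₀ *ᵥ x = 0 → x ∈ Z) :
    ∃ F : Matrix (Fin n) (Fin n) ℂ, F.PosSemidef ∧ (∀ z ∈ U, F *ᵥ z = F₀ *ᵥ z) ∧
      ∀ x, F *ᵥ x = 0 ↔ x ∈ Z := by
  -- Adding the projection onto (Z + U)^⊥ shrinks the kernel to ker F₀ ∩ (Z + U), which is Z because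
  -- U ∩ ker F₀ ⊆ Z ⊆ ker F₀.
  obtain ⟨P, hP, hPP, hPm, hPe⟩ := exists_orthogonal_projection (Z ⊔ U)
  have hH : (1 - P).PosSemidef := by
    have : 1 - P = (1 - P)ᴴ * (1 - P) := by
      rw [conjTranspose_sub, hP, conjTranspose_one, Matrix.sub_mul, Matrix.mul_sub,
        Matrix.mul_sub, hPP]
      simp
    rw [this]
    exact posSemidef_conjTranspose_mul_self _
  have hHe : ∀ x ∈ Z ⊔ U, (1 - P) *ᵥ x = 0 := fun x hx => by
    rw [sub_mulVec, hPe x hx, one_mulVec, sub_self]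
  refine ⟨F₀ + (1 - P), hF₀.add hH, fun z hz => ?_, fun x => ⟨fun h => ?_, fun h => ?_⟩⟩
  · rw [add_mulVec, hHe z (Submodule.mem_sup_right hz), add_zero]
  · have h1 : star x ⬝ᵥ (F₀ *ᵥ x) + star x ⬝ᵥ ((1 - P) *ᵥ x) = 0 := by
      rw [← dotProduct_add, ← add_mulVec, h, dotProduct_zero]
    obtain ⟨h2, h3⟩ := (add_eq_zero_iff_of_nonneg (hF₀.dotProduct_mulVec_nonneg x)
      (hH.dotProduct_mulVec_nonneg x)).1 h1
    rw [hF₀.dotProduct_mulVec_zero_iff] at h2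
    rw [hH.dotProduct_mulVec_zero_iff, sub_mulVec, one_mulVec, sub_eq_zero] at h3
    have h4 : x ∈ Z ⊔ U := by rw [h3]; exact hPm x
    obtain ⟨a, ha, b, hb, rfl⟩ := Submodule.mem_sup.1 h4
    have hFb : F₀ *ᵥ b = 0 := by
      rw [mulVec_add, hZ a ha, zero_add] at h2
      exact h2
    exact Z.add_mem ha (hUZ b hb hFb)
  · rw [add_mulVec, hZ x h, hHe x (Submodule.mem_sup_left h), add_zero]

/-- Existence of a Hermitian modification `F` of `E` in the range of `B` for which the pencil
`λ F - (J - R)` is regular of index at most one, in kernel-range form. -/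
theorem exists_posSemidef_ker_inf_range_eq_bot {E J R : Matrix (Fin n) (Fin n) ℂ}
    (B : Matrix (Fin n) (Fin m) ℂ) (hE : E.PosSemidef) (hR : R.PosSemidef) (hJ : Jᴴ = -J)
    (h1 : ∀ z, E *ᵥ z = 0 → (J - R)ᴴ *ᵥ z = 0 → Bᴴ *ᵥ z = 0 → z = 0)
    (h2 : ∀ z v, Bᴴ *ᵥ z = 0 → E *ᵥ v = 0 → Bᴴ *ᵥ v = 0 → E *ᵥ z = (J - R)ᴴ *ᵥ v →
      E *ᵥ z = 0) :
    ∃ F : Matrix (Fin n) (Fin n) ℂ, F.PosSemidef ∧ (∀ z, Bᴴ *ᵥ z = 0 → F *ᵥ z = E *ᵥ z) ∧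
      ∀ x y, F *ᵥ x = 0 → (J - R) *ᵥ x = F *ᵥ y → x = 0 := by
  set A := J - R
  let U : Submodule ℂ (Fin n → ℂ) := LinearMap.ker Bᴴ.mulVecLin
  obtain ⟨F₀, hF₀, hF₀U, hF₀k⟩ := hE.exists_minimal U
  have hUF₀ : ∀ z ∈ U, F₀ *ᵥ z = 0 → E *ᵥ z = 0 := fun z hz h => hF₀U z hz ▸ h
  obtain ⟨Q, hQ, hQQ, hQm, hQe⟩ := exists_orthogonal_projection (LinearMap.ker F₀.mulVecLin)
  obtain ⟨P, hP, -, hPm, hPe⟩ := exists_orthogonal_projection U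
  let V : Submodule ℂ (Fin n → ℂ) := LinearMap.ker E.mulVecLin ⊓ U
  obtain ⟨PV, hPV, -, hPVm, hPVe⟩ := exists_orthogonal_projection V
  -- N is the radical of the form wᴴAv on V.
  let N : Submodule ℂ (Fin n → ℂ) := V ⊓ LinearMap.ker (PV * A).mulVecLin
  have hN : ∀ v, v ∈ N ↔ v ∈ V ∧ ∀ w ∈ V, star w ⬝ᵥ (A *ᵥ v) = 0 := by
    refine fun v => and_congr_right fun _ => ?_
    rw [← projection_mulVec_eq_zero_iff hPV hPVm hPVe, mulVec_mulVec]
    rfl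
  have hNA : ∀ v ∈ N, Aᴴ *ᵥ v = -(A *ᵥ v) := fun v hv =>
    conjTranspose_sub_mulVec_eq_neg hR hJ (((hN v).1 hv).2 v ((hN v).1 hv).1)
  -- Each v ∈ N gets the partner QAv ∈ ker F₀, whose pairing with Av is the squared norm of QAv.
  let Z : Submodule ℂ (Fin n → ℂ) := V ⊔ N.map (Q * A).mulVecLin
  have hVF₀ : ∀ x ∈ V, F₀ *ᵥ x = 0 := fun x hx => by
    rw [hF₀U x hx.2]; exact hx.1
  have hZF₀ : ∀ x ∈ Z, F₀ *ᵥ x = 0 := by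
    have : Z ≤ LinearMap.ker F₀.mulVecLin := by
      refine sup_le hVF₀ ?_
      rintro _ ⟨v, -, rfl⟩
      rw [mulVecLin_apply, ← mulVec_mulVec]
      exact hQm _
    exact this
  have hZ : ∀ x ∈ Z, (∀ z ∈ Z, star z ⬝ᵥ (A *ᵥ x) = 0) → x = 0 := by
    intro x hx hxZ
    obtain ⟨v, hv, _, ⟨w, hw, rfl⟩, rfl⟩ := Submodule.mem_sup.1 hx
    rw [mulVecLin_apply, ← mulVec_mulVec] at hxZ ⊢
    -- Testing v + QAw against w ∈ V gives -(Aw)ᴴv - (Aw)ᴴQAw, and the first term vanishes because w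
    -- is in the radical.
    have hQw : Q *ᵥ (A *ᵥ w) = 0 := by
      have h3 := hxZ w (Submodule.mem_sup_left ((hN w).1 hw).1)
      have h4 : star (A *ᵥ w) ⬝ᵥ v = 0 :=
        star_dotProduct_eq_zero_comm (((hN w).1 hw).2 v hv)
      rw [star_dotProduct_mulVec_eq, hNA w hw, star_neg, neg_dotProduct, neg_eq_zero,
        dotProduct_add, h4, zero_add] at h3
      exact projection_mulVec_eq_zero hQ hQQ h3
    rw [hQw, add_zero] at hxZ ⊢
    have hvN : v ∈ N := (hN v).2 ⟨hv, fun z hz => hxZ z (Submodule.mem_sup_left hz)⟩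
    have hQv : Q *ᵥ (A *ᵥ v) = 0 := by
      refine projection_mulVec_eq_zero hQ hQQ (star_dotProduct_eq_zero_comm ?_)
      exact hxZ _ (Submodule.mem_sup_right ⟨v, hvN, (mulVec_mulVec v Q A).symm⟩)
    -- Now Av is orthogonal to ker F₀ = ker (PE), so Av lies in range (EP) = EU.
    obtain ⟨u, hu⟩ := exists_conjTranspose_mulVec_eq (P * E) (A *ᵥ v) fun z hz => by
      refine (projection_mulVec_eq_zero_iff hQ hQm hQe _).1 hQv z ((hF₀k z).2 ?_)
      rw [← mulVec_mulVec] at hz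
      exact (projection_mulVec_eq_zero_iff hP hPm hPe _).1 hz
    rw [conjTranspose_mul, hP, hE.isHermitian.eq, ← mulVec_mulVec] at hu
    have hEu : E *ᵥ (-(P *ᵥ u)) = Aᴴ *ᵥ v := by rw [mulVec_neg, hu, hNA v hvN]
    have h0 := h2 _ v (U.neg_mem (hPm u)) hv.1 hv.2 hEu
    exact h1 v hv.1 (hEu ▸ h0) hv.2
  obtain ⟨F, hF, hFU, hFk⟩ := hF₀.exists_ker_eq U Z hZF₀
    fun x hx h => Submodule.mem_sup_left ⟨hUF₀ x hx h, hx⟩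
  refine ⟨F, hF, fun z hz => (hFU z hz).trans (hF₀U z hz), fun x y hx hxy => ?_⟩
  refine hZ x ((hFk x).1 hx) fun z hz => ?_
  rw [hxy, star_dotProduct_mulVec_eq, hF.isHermitian.eq, (hFk z).2 hz]
  simp

end Matrix

/-! ### Weierstrass form and index at most one. -/

namespace Matrix

variable {l m n : ℕ}

theorem reindex_self_mul {α : Type*} [Fintype α] (e : α ≃ Fin n) (M N : Matrix α α ℂ) :
    M.reindex e e * N.reindex e e = (M * N).reindex e e := by
  simp [submatrix_mul_equiv]

theorem reindex_self_add {α : Type*} (e : α ≃ Fin n) (M N : Matrix α α ℂ) :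
    M.reindex e e + N.reindex e e = (M + N).reindex e e := rfl

theorem reindex_self_sub {α : Type*} (e : α ≃ Fin n) (M N : Matrix α α ℂ) :
    M.reindex e e - N.reindex e e = (M - N).reindex e e := rfl

theorem reindex_self_mulVec_single {α : Type*} [DecidableEq α] (e : α ≃ Fin n)
    (M : Matrix α α ℂ) (k : α) :
    M.reindex e e *ᵥ Pi.single (e k) 1 = fun i => M (e.symm i) k := by
  ext i
  simp

theorem mulVec_mem_of_single_mem {M : Matrix (Fin l) (Fin n) ℂ} {W : Submodule ℂ (Fin l → ℂ)}
    (h : ∀ i, M *ᵥ Pi.single i 1 ∈ W) (x : Fin n → ℂ) : M *ᵥ x ∈ W := by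
  have h1 : LinearMap.range M.mulVecLin ≤ W := by
    rw [range_mulVecLin, Submodule.span_le]
    rintro _ ⟨i, rfl⟩
    simpa [mulVec_single_one] using h i
  exact h1 ⟨x, rfl⟩

end Matrix

open Matrix

variable {l m n : ℕ}

theorem eq_zero_of_nilpotencyClass_le_one {M : Type*} [MonoidWithZero M] {a : M}
    (ha : IsNilpotent a) (h : nilpotencyClass a ≤ 1) : a = 0 := by
  have h1 := pow_nilpotencyClass ha
  simpa using pow_eq_zero_of_le h h1

/-- In a pencil of index at most one, every vector can be corrected by an element of `ker F` so
that its image under `A` lies in the range of `F`. -/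
theorem HasPencilIndex.exists_correction {F A : Matrix (Fin n) (Fin n) ℂ} {ν : ℕ}
    (h : HasPencilIndex F A ν) (hν : ν ≤ 1) (x : Fin n → ℂ) :
    ∃ w y, F *ᵥ w = 0 ∧ A *ᵥ (x - w) = F *ᵥ y := by
  obtain ⟨p, q, e, S, T, C, N, hS, hT, hF, hA, hN, hNν⟩ := h
  obtain rfl := eq_zero_of_nilpotencyClass_le_one hN (hNν.trans_le hν)
  have hS' : S⁻¹ * S = 1 := nonsing_inv_mul _ ((isUnit_iff_isUnit_det _).1 hS)
  have hT' : T * T⁻¹ = 1 := mul_nonsing_inv _ ((isUnit_iff_isUnit_det _).1 hT)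
  have hSinj : ∀ {M M' : Matrix (Fin n) (Fin n) ℂ}, S * M = S * M' → M = M' := fun {M M'} h => by
    rw [← Matrix.one_mul M, ← Matrix.one_mul M', ← hS', Matrix.mul_assoc, h, Matrix.mul_assoc]
  -- D₁ and D₂ are the coordinate projections onto the finite and infinite blocks; the correction w
  -- is the infinite part of x.
  set D₁ : Matrix (Fin n) (Fin n) ℂ := (fromBlocks (1 : Matrix (Fin p) (Fin p) ℂ) 0 0
    (0 : Matrix (Fin q) (Fin q) ℂ)).reindex e e with hD₁
  set D₂ : Matrix (Fin n) (Fin n) ℂ := (fromBlocks (0 : Matrix (Fin p) (Fin p) ℂ) 0 0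
    (1 : Matrix (Fin q) (Fin q) ℂ)).reindex e e with hD₂
  set X : Matrix (Fin n) (Fin n) ℂ := (fromBlocks C 0 0
    (1 : Matrix (Fin q) (Fin q) ℂ)).reindex e e with hX
  have h12 : D₁ * D₂ = 0 := by
    rw [reindex_self_mul, fromBlocks_multiply]; simp
  have h1X : X * D₁ = D₁ * X := by
    rw [reindex_self_mul, reindex_self_mul, fromBlocks_multiply, fromBlocks_multiply]; simp
  have hD : D₁ + D₂ = 1 := by
    rw [hD₁, hD₂, reindex_self_add, fromBlocks_add]; simp
  have hFD₂ : F * (T * D₂) = 0 := hSinj (by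
    rw [← Matrix.mul_assoc, ← Matrix.mul_assoc, hF, h12, Matrix.mul_zero])
  have hAD₁ : A * (T * D₁) = F * (T * X) := hSinj (by
    rw [← Matrix.mul_assoc, ← Matrix.mul_assoc, ← Matrix.mul_assoc, ← Matrix.mul_assoc, hF, hA,
      h1X])
  refine ⟨(T * D₂) *ᵥ (T⁻¹ *ᵥ x), (T * X) *ᵥ (T⁻¹ *ᵥ x), ?_, ?_⟩
  · rw [mulVec_mulVec, hFD₂, zero_mulVec]
  · have hx : x - (T * D₂) *ᵥ (T⁻¹ *ᵥ x) = (T * D₁) *ᵥ (T⁻¹ *ᵥ x) := by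
      rw [sub_eq_iff_eq_add, ← add_mulVec, ← Matrix.mul_add, hD, Matrix.mul_one, mulVec_mulVec,
        hT', one_mulVec]
    rw [hx, mulVec_mulVec, hAD₁, mulVec_mulVec (T⁻¹ *ᵥ x)]

/-- A regular pencil has no common left null vector. -/
theorem IsRegularPencil.eq_zero_of_conjTranspose {F A : Matrix (Fin n) (Fin n) ℂ}
    (h : IsRegularPencil F A) {z : Fin n → ℂ} (hF : Fᴴ *ᵥ z = 0) (hA : Aᴴ *ᵥ z = 0) : z = 0 := by
  obtain ⟨s, hs⟩ := h
  have hs' : ((s • F - A)ᴴ).det ≠ 0 := by rw [det_conjTranspose]; exact star_ne_zero.2 hs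
  refine eq_zero_of_mulVec_eq_zero hs' ?_
  rw [conjTranspose_sub, conjTranspose_smul, sub_mulVec, smul_mulVec, hF, hA]
  simp

theorem exists_det_smul_one_sub_ne_zero {p : ℕ} (C : Matrix (Fin p) (Fin p) ℂ) :
    ∃ s : ℂ, (s • (1 : Matrix (Fin p) (Fin p) ℂ) - C).det ≠ 0 := by
  obtain ⟨s, hs⟩ : ∃ s, C.charpoly.eval s ≠ 0 := by
    by_contra! h
    exact C.charpoly_monic.ne_zero (Polynomial.funext fun s => by simpa using h s)
  refine ⟨s, ?_⟩
  rw [eval_charpoly] at hs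
  simpa [smul_one_eq_diagonal] using hs

/-- A pencil in Weierstrass form with zero nilpotent part is regular of index at most one. -/
theorem isRegularPencil_and_hasPencilIndex {F A S T : Matrix (Fin n) (Fin n) ℂ} {p q : ℕ}
    (e : Fin p ⊕ Fin q ≃ Fin n) (C : Matrix (Fin p) (Fin p) ℂ) (hS : IsUnit S) (hT : IsUnit T)
    (hF : S * F * T = (fromBlocks 1 0 0 0).reindex e e)
    (hA : S * A * T = (fromBlocks C 0 0 1).reindex e e) :
    IsRegularPencil F A ∧ ∃ ν ≤ 1, HasPencilIndex F A ν := by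
  constructor
  · obtain ⟨s, hs⟩ := exists_det_smul_one_sub_ne_zero C
    refine ⟨s, fun h => ?_⟩
    have h1 : S * (s • F - A) * T =
        (fromBlocks (s • 1 - C) 0 0 (-1 : Matrix (Fin q) (Fin q) ℂ)).reindex e e := by
      have h2 : s • (fromBlocks 1 0 0 (0 : Matrix (Fin q) (Fin q) ℂ)).reindex e e =
          (s • fromBlocks (1 : Matrix (Fin p) (Fin p) ℂ) 0 0
            (0 : Matrix (Fin q) (Fin q) ℂ)).reindex e e := rfl
      rw [Matrix.mul_sub, Matrix.sub_mul, Matrix.mul_smul, Matrix.smul_mul, hF, hA, h2,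
        reindex_self_sub, fromBlocks_smul, sub_eq_add_neg, fromBlocks_neg, fromBlocks_add]
      simp [sub_eq_add_neg]
    have h2 := congrArg det h1
    rw [det_mul, det_mul, h, det_reindex_self, det_fromBlocks_zero₂₁, mul_zero, zero_mul] at h2
    rcases mul_eq_zero.1 h2.symm with h3 | h3
    · exact hs h3
    · simp [det_neg] at h3
  · refine ⟨nilpotencyClass (0 : Matrix (Fin q) (Fin q) ℂ), ?_, p, q, e, S, T, C, 0, hS, hT, hF,
      hA, IsNilpotent.zero, rfl⟩
    -- Only an upper bound holds uniformly: for q = 0 the nilpotency class is 0.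
    exact Nat.sInf_le (by simp)

/-- If `ker F` meets `A⁻¹ (range F)` only in zero, then the two are complementary. -/
theorem isCompl_ker_comap_range {F A : Matrix (Fin n) (Fin n) ℂ}
    (h : ∀ x y, F *ᵥ x = 0 → A *ᵥ x = F *ᵥ y → x = 0) :
    IsCompl ((LinearMap.range F.mulVecLin).comap A.mulVecLin) (LinearMap.ker F.mulVecLin) := by
  set W := (LinearMap.range F.mulVecLin).comap A.mulVecLin
  have hdisj : Disjoint W (LinearMap.ker F.mulVecLin) := by
    rw [Submodule.disjoint_def]
    rintro x ⟨y, hy⟩ hx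
    exact h x y hx hy.symm
  refine ⟨hdisj, ?_⟩
  rw [codisjoint_iff]
  refine Submodule.eq_top_of_disjoint W _ ?_ hdisj
  -- W is the kernel of a map into ℂⁿ / range F, so dim W ≥ rank F = n - dim ker F.
  have h1 := LinearMap.finrank_range_add_finrank_ker F.mulVecLin
  have h2 := LinearMap.finrank_range_add_finrank_ker
    ((LinearMap.range F.mulVecLin).mkQ ∘ₗ A.mulVecLin)
  have h3 : LinearMap.ker ((LinearMap.range F.mulVecLin).mkQ ∘ₗ A.mulVecLin) = W := by
    rw [LinearMap.ker_comp, Submodule.ker_mkQ]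
  have h4 := Submodule.finrank_le
    (LinearMap.range ((LinearMap.range F.mulVecLin).mkQ ∘ₗ A.mulVecLin))
  have h5 := Submodule.finrank_quotient_add_finrank (LinearMap.range F.mulVecLin)
  rw [h3] at h2
  omega

/-- A pencil such that `ker F` meets `A⁻¹ (range F)` only in zero is regular of index at most
one. -/
theorem isRegularPencil_and_hasPencilIndex_of_ker {F A : Matrix (Fin n) (Fin n) ℂ}
    (h : ∀ x y, F *ᵥ x = 0 → A *ᵥ x = F *ᵥ y → x = 0) :
    IsRegularPencil F A ∧ ∃ ν ≤ 1, HasPencilIndex F A ν := by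
  have hc := isCompl_ker_comap_range h
  set W := (LinearMap.range F.mulVecLin).comap A.mulVecLin
  set K := LinearMap.ker F.mulVecLin
  let b := ((Module.finBasis ℂ W).prod (Module.finBasis ℂ K)).map
    (Submodule.prodEquivOfIsCompl W K hc)
  let e : Fin (Module.finrank ℂ W) ⊕ Fin (Module.finrank ℂ K) ≃ Fin n :=
    b.indexEquiv (Pi.basisFun ℂ (Fin n))
  let b' := b.reindex e
  set T : Matrix (Fin n) (Fin n) ℂ := (Pi.basisFun ℂ (Fin n)).toMatrix b' with hT
  have hTu : IsUnit T := by
    have := (Pi.basisFun ℂ (Fin n)).invertibleToMatrix b'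
    exact isUnit_of_invertible T
  set D₁ : Matrix (Fin n) (Fin n) ℂ := (fromBlocks
    (1 : Matrix (Fin (Module.finrank ℂ W)) (Fin (Module.finrank ℂ W)) ℂ) 0 0
    (0 : Matrix (Fin (Module.finrank ℂ K)) (Fin (Module.finrank ℂ K)) ℂ)).reindex e e with hD₁
  set D₂ : Matrix (Fin n) (Fin n) ℂ := (fromBlocks
    (0 : Matrix (Fin (Module.finrank ℂ W)) (Fin (Module.finrank ℂ W)) ℂ) 0 0
    (1 : Matrix (Fin (Module.finrank ℂ K)) (Fin (Module.finrank ℂ K)) ℂ)).reindex e e with hD₂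
  have hTi : ∀ i, T *ᵥ Pi.single i 1 = b' i := fun i => by
    ext j
    simp [hT, Module.Basis.toMatrix_apply]
  have hD : D₁ + D₂ = 1 := by
    rw [hD₁, hD₂, reindex_self_add, fromBlocks_add]; simp
  have h11 : D₁ * D₁ = D₁ := by
    rw [hD₁, reindex_self_mul, fromBlocks_multiply]; simp
  have h12 : D₁ * D₂ = 0 := by
    rw [reindex_self_mul, fromBlocks_multiply]; simp
  have h21 : D₂ * D₁ = 0 := by
    rw [reindex_self_mul, fromBlocks_multiply]; simp
  have h22 : D₂ * D₂ = D₂ := by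
    rw [hD₂, reindex_self_mul, fromBlocks_multiply]; simp
  have hTb : ∀ k, T *ᵥ Pi.single (e k) 1 = b k := fun k => by
    rw [hTi]; simp [b']
  have hD1l : ∀ i, D₁ *ᵥ Pi.single (e (Sum.inl i)) 1 = Pi.single (e (Sum.inl i)) 1 := fun i => by
    rw [hD₁, reindex_self_mulVec_single]
    funext j
    obtain ⟨k, rfl⟩ := e.surjective j
    rcases k with k | k <;> simp [one_apply, Pi.single_apply]
  have hD1r : ∀ i, D₁ *ᵥ Pi.single (e (Sum.inr i)) 1 = 0 := fun i => by
    rw [hD₁, reindex_self_mulVec_single]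
    funext j
    rcases e.symm j with k | k <;> simp
  have hTD₁ : ∀ x, (T * D₁) *ᵥ x ∈ W := by
    refine mulVec_mem_of_single_mem fun i => ?_
    obtain ⟨k, rfl⟩ := e.surjective i
    rw [← mulVec_mulVec]
    rcases k with k | k
    · rw [hD1l, hTb]
      simp [b]
    · rw [hD1r, mulVec_zero]
      exact W.zero_mem
  have hTD₂ : ∀ x, (T * D₂) *ᵥ x ∈ K := by
    refine mulVec_mem_of_single_mem fun i => ?_
    obtain ⟨k, rfl⟩ := e.surjective i
    rw [eq_sub_iff_add_eq'.2 hD, ← mulVec_mulVec, sub_mulVec, one_mulVec]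
    rcases k with k | k
    · rw [hD1l, sub_self, mulVec_zero]
      exact K.zero_mem
    · rw [hD1r, sub_zero, hTb]
      simp [b]
  have hFT : F * T * D₂ = 0 := by
    refine ext_of_mulVec_single fun i => ?_
    rw [Matrix.mul_assoc, ← mulVec_mulVec, zero_mulVec]
    exact hTD₂ _
  have hFT' : F * T * D₁ = F * T := by
    rw [← add_zero (F * T * D₁), ← hFT, ← Matrix.mul_add, hD, Matrix.mul_one]
  have hTinj : ∀ x, T *ᵥ x = 0 → x = 0 := fun x hx => by
    have := congrArg (T⁻¹ *ᵥ ·) hx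
    simpa [mulVec_mulVec, nonsing_inv_mul _ ((isUnit_iff_isUnit_det _).1 hTu)] using this
  -- The columns of M are the F-images of the basis of W and the A-images of the basis of ker F.
  -- They form a basis of ℂⁿ, and M⁻¹ is the left transformation.
  set M : Matrix (Fin n) (Fin n) ℂ := F * T * D₁ + A * T * D₂ with hM
  have hM₁ : M * D₁ = F * T := by
    rw [hM, Matrix.add_mul, Matrix.mul_assoc (F * T), h11, Matrix.mul_assoc (A * T), h21,
      Matrix.mul_zero, add_zero, hFT']
  have hM₂ : M * D₂ = A * T * D₂ := by
    rw [hM, Matrix.add_mul, Matrix.mul_assoc (F * T), h12, Matrix.mul_assoc (A * T), h22,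
      Matrix.mul_zero, zero_add]
  have hMu : IsUnit M := by
    rw [← mulVec_injective_iff_isUnit]
    refine (injective_iff_map_eq_zero M.mulVecLin).2 fun x hx => ?_
    rw [mulVecLin_apply, hM, add_mulVec] at hx
    have h1 : (T * D₂) *ᵥ x = 0 := by
      refine h _ (-((T * D₁) *ᵥ x)) (hTD₂ x) ?_
      rw [mulVec_neg, eq_neg_iff_add_eq_zero, add_comm, mulVec_mulVec, mulVec_mulVec,
        ← Matrix.mul_assoc, ← Matrix.mul_assoc, hx]
    have h2 : (T * D₁) *ᵥ x = 0 := by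
      refine (Submodule.disjoint_def.1 hc.disjoint) _ (hTD₁ x) ?_
      rw [Matrix.mul_assoc A, ← mulVec_mulVec _ A, h1, mulVec_zero, add_zero,
        Matrix.mul_assoc, ← mulVec_mulVec] at hx
      exact hx
    apply hTinj
    rw [← Matrix.mul_one T, ← hD, Matrix.mul_add, add_mulVec, h1, h2, add_zero]
  have hMi : M⁻¹ * M = 1 := nonsing_inv_mul _ ((isUnit_iff_isUnit_det _).1 hMu)
  have hF1 : M⁻¹ * F * T = D₁ := by
    rw [Matrix.mul_assoc, ← hM₁, ← Matrix.mul_assoc, hMi, Matrix.one_mul]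
  set X := M⁻¹ * A * T with hX
  have hX₂ : X * D₂ = D₂ := by
    rw [hX, Matrix.mul_assoc, Matrix.mul_assoc, ← Matrix.mul_assoc A, ← hM₂, ← Matrix.mul_assoc,
      hMi, Matrix.one_mul]
  -- A maps W into range F, and D₂M⁻¹ annihilates range F.
  have hX₁ : D₂ * X * D₁ = 0 := by
    refine ext_of_mulVec_single fun i => ?_
    obtain ⟨y, hy⟩ := hTD₁ (Pi.single i 1)
    have hTT : T * T⁻¹ = 1 := mul_nonsing_inv _ ((isUnit_iff_isUnit_det _).1 hTu)
    have hy' : F *ᵥ y = A *ᵥ ((T * D₁) *ᵥ Pi.single i 1) := hy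
    have h3 : D₂ * X * D₁ = D₂ * M⁻¹ * (A * (T * D₁)) := by
      simp only [hX, Matrix.mul_assoc]
    have h4 : D₂ * M⁻¹ * F = 0 := by
      rw [← Matrix.mul_one F, ← hTT, ← Matrix.mul_assoc F, ← hM₁, Matrix.mul_assoc D₂,
        ← Matrix.mul_assoc M⁻¹, ← Matrix.mul_assoc M⁻¹, hMi, Matrix.one_mul, ← Matrix.mul_assoc,
        h21, Matrix.zero_mul]
    rw [h3, ← mulVec_mulVec, ← mulVec_mulVec _ A, ← hy', mulVec_mulVec, h4, zero_mulVec,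
      zero_mulVec]
  have hX₃ : D₂ * X = D₂ := by
    rw [← Matrix.mul_one (D₂ * X), ← hD, Matrix.mul_add, hX₁, zero_add, Matrix.mul_assoc, hX₂, h22]
  obtain ⟨Y, hY⟩ := (reindex e e).surjective X
  rw [← fromBlocks_toBlocks Y] at hY
  rw [← hY, hD₂, reindex_self_mul, (reindex e e).injective.eq_iff, fromBlocks_multiply] at hX₂ hX₃
  rw [fromBlocks_inj] at hX₂ hX₃
  refine isRegularPencil_and_hasPencilIndex e Y.toBlocks₁₁
    ((isUnit_nonsing_inv_iff).2 hMu) hTu hF1 ?_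
  rw [← hX, ← hY]
  simp only [Matrix.mul_zero, Matrix.mul_one, Matrix.zero_mul, Matrix.one_mul, zero_add,
    add_zero] at hX₂ hX₃
  rw [hX₂.2.1, hX₂.2.2.2, hX₃.2.2.1]

/-! ### The rank conditions in terms of vectors. -/

open Matrix

variable {l m n k : ℕ}

theorem Matrix.rank_add_finrank_ker_conjTranspose {ι : Type*} [Fintype ι]
    (M : Matrix (Fin n) ι ℂ) :
    M.rank + Module.finrank ℂ (LinearMap.ker Mᴴ.mulVecLin) = n := by
  rw [← rank_conjTranspose]
  exact (LinearMap.finrank_range_add_finrank_ker Mᴴ.mulVecLin).trans (Module.finrank_fin_fun ℂ)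

theorem Matrix.rank_eq_card_iff_conjTranspose {ι : Type*} [Fintype ι] (M : Matrix (Fin n) ι ℂ) :
    M.rank = n ↔ ∀ z, Mᴴ *ᵥ z = 0 → z = 0 := by
  have h := M.rank_add_finrank_ker_conjTranspose
  have h1 : M.rank = n ↔ Module.finrank ℂ (LinearMap.ker Mᴴ.mulVecLin) = 0 := by omega
  rw [h1, Submodule.finrank_eq_zero, LinearMap.ker_eq_bot']
  rfl

theorem Matrix.conjTranspose_fromCols_mulVec_eq_zero {ι κ : Type*} [Fintype ι] [Fintype κ]
    (M : Matrix (Fin n) ι ℂ) (N : Matrix (Fin n) κ ℂ) (z : Fin n → ℂ) :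
    (fromCols M N)ᴴ *ᵥ z = 0 ↔ Mᴴ *ᵥ z = 0 ∧ Nᴴ *ᵥ z = 0 := by
  rw [conjTranspose_fromCols_eq_fromRows_conjTranspose, fromRows_mulVec]
  simp [funext_iff]

section NullBasis

variable {ι : Type*} [Fintype ι] {M : Matrix (Fin n) ι ℂ} {T : Matrix (Fin n) (Fin k) ℂ}

theorem IsLeftNullBasis.range_eq (h : IsLeftNullBasis M T) :
    LinearMap.range T.mulVecLin = LinearMap.ker Mᴴ.mulVecLin := by
  rw [range_mulVecLin]
  refine SetLike.coe_injective (h.2.trans ?_)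
  ext x
  have h1 : star x ᵥ* M = star (Mᴴ *ᵥ x) := by rw [star_mulVec, conjTranspose_conjTranspose]
  simp [h1]

theorem IsLeftNullBasis.injective (h : IsLeftNullBasis M T) :
    Function.Injective T.mulVecLin :=
  mulVec_injective_iff.2 h.1

theorem IsLeftNullBasis.rank_add (h : IsLeftNullBasis M T) : M.rank + k = n := by
  have h1 := M.rank_add_finrank_ker_conjTranspose
  rwa [← h.range_eq, LinearMap.finrank_range_of_inj h.injective, Module.finrank_fin_fun] at h1

theorem IsRightNullBasis.range_eq {M : Matrix (Fin l) (Fin n) ℂ} (h : IsRightNullBasis M T) :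
    LinearMap.range T.mulVecLin = LinearMap.ker M.mulVecLin := by
  rw [range_mulVecLin]
  refine SetLike.coe_injective (h.2.trans ?_)
  ext x
  simp

/-- The columns of T span ker M, whose orthogonal complement is range Mᴴ. -/
theorem IsRightNullBasis.conjTranspose_mulVec_eq_zero_iff {M : Matrix (Fin l) (Fin n) ℂ}
    (h : IsRightNullBasis M T) (y : Fin n → ℂ) : Tᴴ *ᵥ y = 0 ↔ ∃ w, Mᴴ *ᵥ w = y := by
  constructor
  · intro hy
    refine exists_conjTranspose_mulVec_eq M y fun x hx => ?_
    obtain ⟨c, rfl⟩ : x ∈ LinearMap.range T.mulVecLin := h.range_eq ▸ hx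
    have h1 := star_dotProduct_mulVec_eq Tᴴ c y
    rw [hy, dotProduct_zero, conjTranspose_conjTranspose] at h1
    exact h1.symm
  · rintro ⟨w, rfl⟩
    have h1 : M * T = 0 := by
      refine ext_of_mulVec_single fun i => ?_
      rw [← mulVec_mulVec, zero_mulVec]
      have : T *ᵥ Pi.single i 1 ∈ LinearMap.ker M.mulVecLin := h.range_eq ▸ ⟨_, rfl⟩
      exact this
    rw [mulVec_mulVec, ← conjTranspose_mul, h1, conjTranspose_zero, zero_mulVec]

end NullBasis

/-- The second rank condition in terms of vectors. -/
theorem rank_eq_rank_sub_rank_iff {p q r : ℕ} {E A : Matrix (Fin n) (Fin n) ℂ}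
    {B : Matrix (Fin n) (Fin m) ℂ} (hE : E.IsHermitian)
    {TB : Matrix (Fin n) (Fin p) ℂ} (hTB : IsLeftNullBasis B TB)
    {TEB : Matrix (Fin n) (Fin q) ℂ} (hTEB : IsLeftNullBasis (fromCols E B) TEB)
    {S : Matrix (Fin n) (Fin r) ℂ} (hS : IsRightNullBasis (TEBᴴ * A) S) :
    ((TBᴴ * E * S).rank : ℤ) = ((fromCols E B).rank : ℤ) - (B.rank : ℤ) ↔
      ∀ z v, Bᴴ *ᵥ z = 0 → E *ᵥ v = 0 → Bᴴ *ᵥ v = 0 → E *ᵥ z = Aᴴ *ᵥ v → E *ᵥ z = 0 := by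
  have h1 := hTB.rank_add
  have h2 := hTEB.rank_add
  have h3 := (TBᴴ * E * S).rank_add_finrank_ker_conjTranspose
  set K := LinearMap.ker (TBᴴ * E * S)ᴴ.mulVecLin
  -- Here p = n - rank B, q = n - rank [E, B], and the rank on the left is p - dim K.
  have h4 : ((TBᴴ * E * S).rank : ℤ) = ((fromCols E B).rank : ℤ) - (B.rank : ℤ) ↔
      Module.finrank ℂ K = q := by omega
  have hV : ∀ z, z ∈ LinearMap.range TEB.mulVecLin ↔ E *ᵥ z = 0 ∧ Bᴴ *ᵥ z = 0 := fun z => by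
    rw [hTEB.range_eq, LinearMap.mem_ker, mulVecLin_apply, conjTranspose_fromCols_mulVec_eq_zero,
      hE.eq]
  -- Since ker Sᴴ = Aᴴ(V), the image of K is {z ∈ U : Ez ∈ Aᴴ(V)}. It contains V, of dimension q, so
  -- dim K = q means that it equals V.
  have hK : ∀ z, z ∈ K.map TB.mulVecLin ↔ Bᴴ *ᵥ z = 0 ∧ Sᴴ *ᵥ (E *ᵥ z) = 0 := fun z => by
    have h5 : (TBᴴ * E * S)ᴴ = Sᴴ * (E * TB) := by
      rw [conjTranspose_mul, conjTranspose_mul, conjTranspose_conjTranspose, hE.eq]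
    have h6 : ∀ z, z ∈ LinearMap.range TB.mulVecLin ↔ Bᴴ *ᵥ z = 0 := fun z => by
      rw [hTB.range_eq]; rfl
    have h7 : ∀ c, c ∈ K ↔ Sᴴ *ᵥ (E *ᵥ (TB *ᵥ c)) = 0 := fun c => by
      rw [LinearMap.mem_ker, mulVecLin_apply, h5, mulVec_mulVec, mulVec_mulVec, Matrix.mul_assoc]
    rw [← h6]
    constructor
    · rintro ⟨c, hc, rfl⟩
      exact ⟨⟨c, rfl⟩, (h7 c).1 hc⟩
    · rintro ⟨⟨c, rfl⟩, hc⟩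
      exact ⟨c, (h7 c).2 hc, rfl⟩
  have hle : LinearMap.range TEB.mulVecLin ≤ K.map TB.mulVecLin := fun z hz => by
    obtain ⟨hz1, hz2⟩ := (hV z).1 hz
    exact (hK z).2 ⟨hz2, by rw [hz1, mulVec_zero]⟩
  have hq : Module.finrank ℂ (LinearMap.range TEB.mulVecLin) = q := by
    rw [LinearMap.finrank_range_of_inj hTEB.injective, Module.finrank_fin_fun]
  have hKf : Module.finrank ℂ (K.map TB.mulVecLin) = Module.finrank ℂ K :=
    (Submodule.equivMapOfInjective _ hTB.injective K).finrank_eq.symm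
  rw [h4]
  constructor
  · intro h z v hz hv1 hv2 hzv
    have heq := Submodule.eq_of_le_of_finrank_eq hle (by rw [hq, hKf, h])
    refine ((hV z).1 (heq ▸ (hK z).2 ⟨hz, ?_⟩)).1
    obtain ⟨w, hw⟩ := (hV v).2 ⟨hv1, hv2⟩
    refine (hS.conjTranspose_mulVec_eq_zero_iff _).2 ⟨w, ?_⟩
    rw [conjTranspose_mul, conjTranspose_conjTranspose, ← mulVec_mulVec, hzv, ← hw]
    rfl
  · intro h
    rw [← hKf, ← hq]
    refine congrArg (fun W : Submodule ℂ (Fin n → ℂ) => Module.finrank ℂ W)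
      (le_antisymm (fun z hz => ?_) hle)
    obtain ⟨hz1, hz2⟩ := (hK z).1 hz
    obtain ⟨w, hw⟩ := (hS.conjTranspose_mulVec_eq_zero_iff _).1 hz2
    obtain ⟨hv1, hv2⟩ := (hV _).1 ⟨w, rfl⟩
    rw [conjTranspose_mul, conjTranspose_conjTranspose, ← mulVec_mulVec] at hw
    exact (hV z).2 ⟨h z _ hz1 hv1 hv2 hw.symm, hz1⟩

/-! ### The equivalence. -/

theorem mainTheorem6 {n m p q r : ℕ}
    (E J R : Matrix (Fin n) (Fin n) ℂ) (B : Matrix (Fin n) (Fin m) ℂ)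
    (hE : E.PosSemidef) (hR : R.PosSemidef) (hJ : Jᴴ = -J)
    (TB : Matrix (Fin n) (Fin p) ℂ) (hTB : IsLeftNullBasis B TB)
    (TEB : Matrix (Fin n) (Fin q) ℂ) (hTEB : IsLeftNullBasis (Matrix.fromCols E B) TEB)
    (S : Matrix (Fin n) (Fin r) ℂ) (hS : IsRightNullBasis (TEBᴴ * (J - R)) S) :
    (∃ K : Matrix (Fin m) (Fin m) ℂ,
      (E + B * K * Bᴴ).PosSemidef ∧
      IsRegularPencil (E + B * K * Bᴴ) (J - R) ∧
      ∃ ν : ℕ, ν ≤ 1 ∧ HasPencilIndex (E + B * K * Bᴴ) (J - R) ν) ↔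
    ((Matrix.fromCols E (Matrix.fromCols (J - R) B)).rank = n ∧
      ((TBᴴ * E * S).rank : ℤ) = ((Matrix.fromCols E B).rank : ℤ) - (B.rank : ℤ)) := by
  rw [rank_eq_rank_sub_rank_iff hE.isHermitian hTB hTEB hS, rank_eq_card_iff_conjTranspose]
  simp only [conjTranspose_fromCols_mulVec_eq_zero, hE.isHermitian.eq]
  constructor
  · rintro ⟨K, hF, hreg, ν, hν, hind⟩
    set F := E + B * K * Bᴴ
    have hFz : ∀ z, Bᴴ *ᵥ z = 0 → F *ᵥ z = E *ᵥ z := fun z hz => by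
      rw [add_mulVec, ← mulVec_mulVec, hz, mulVec_zero, add_zero]
    refine ⟨fun z ⟨h1, h2, h3⟩ => ?_, fun z v hz hv1 hv2 hzv => ?_⟩
    · refine hreg.eq_zero_of_conjTranspose ?_ h2
      rw [hF.isHermitian.eq, hFz z h3, h1]
    · have hFv : F *ᵥ v = 0 := (hFz v hv2).trans hv1
      -- The squared norm of Aᴴv is vᴴA(Aᴴv). Writing A(Aᴴv) = Fy + Aw with Fw = 0, one has vᴴFy = 0
      -- as Fv = 0, and vᴴAw = (Fz)ᴴw = zᴴFw = 0.
      rw [hzv, ← dotProduct_star_self_eq_zero, ← star_dotProduct_mulVec_eq]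
      obtain ⟨w, y, hw, hy⟩ := hind.exists_correction hν ((J - R)ᴴ *ᵥ v)
      rw [← sub_add_cancel ((J - R)ᴴ *ᵥ v) w, mulVec_add, hy, dotProduct_add,
        star_dotProduct_mulVec_eq, hF.isHermitian.eq, hFv, star_zero, zero_dotProduct, zero_add,
        star_dotProduct_mulVec_eq, ← hzv, ← hFz z hz]
      nth_rw 1 [← hF.isHermitian.eq]
      rw [← star_dotProduct_mulVec_eq, hw, dotProduct_zero]
  · rintro ⟨h1, h2⟩
    obtain ⟨F, hF, hFE, hFA⟩ := exists_posSemidef_ker_inf_range_eq_bot B hE hR hJ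
      (fun z hz1 hz2 hz3 => h1 z ⟨hz1, hz2, hz3⟩) h2
    obtain ⟨K, hK⟩ := (hF.isHermitian.sub hE.isHermitian).exists_eq_mul_mul_conjTranspose B
      fun x hx => by rw [sub_mulVec, hFE x hx, sub_self]
    obtain rfl : F = E + B * K * Bᴴ := by rw [← hK, add_sub_cancel]
    obtain ⟨hreg, ν, hν, hind⟩ := isRegularPencil_and_hasPencilIndex_of_ker hFA
    exact ⟨K, hF, hreg, ν, hν, hind⟩
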